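/- Let $\mathcal H$ be a real Hilbert space and let $\mathcal F:\mathcal H\to\mathbb R$ be twice continuously Fréchet differentiable with locally Lipschitz continuous second derivative and gradient $\mathcal G$. Let $u^*$ be a local minimizer of $\mathcal F$ such that $\delta_{\inf}\|v\|^2\le \mathcal F''(u^*)(v,v)\le\delta_{\sup}\|v\|^2$ for all $v\in\mathcal H$, with constants $0<\delta_{\inf}\le\delta_{\sup}$. A BB sequence of $\mathcal G$ with rule $(c_k)_{k\ge1}$, $c_k\in\{\mathrm{BB1},\mathrm{BB2}\}$, is a sequence with $u_1\ne u_0$ and $$u_{k+1}=u_k-\tfrac1{\alpha_k}\mathcal G(u_k)\quad(k\ge 1),\qquad \alpha_k=\frac{(S_{k-1},Y_{k-1})}{(S_{k-1},S_{k-1})}\ \text{ if } c_k=\mathrm{BB1},\qquad \alpha_k=\frac{(Y_{k-1},Y_{k-1})}{(S_{k-1},Y_{k-1})}\ \text{ if } c_k=\mathrm{BB2},$$ where $S_{k-1}=u_k-u_{k-1}$ and $Y_{k-1}=\mathcal G(u_k)-\mathcal G(u_{k-1})$. If $\mathcal G(u_k)=0$ for some $k\ge1$, the method stops and $u_j:=u_k$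 for $j\ge k$. BB sequences of a mapping on another Hilbert space are defined in the same way. For each $h>0$ let $\mathcal H^h$ be a finite-dimensional Hilbert space with inner product $(\cdot,\cdot)_h$ and norm $\|\cdot\|_h$, let $\mathcal G^h:\mathcal H^h\to\mathcal H^h$ be continuous, and let $\mathbb P^h:\mathcal H^h\to\mathcal H$ be linear. For $v^h\in\mathcal H^h$ write $v^h\overset{\mathcal H}{\to}v$ if $\lim_{h\downarrow0}\|\mathbb P^hv^h-v\|=0$. For a set $U\subseteq\mathcal H$ consider the conditions: (A1) if $v^h\overset{\mathcal H}{\to}v$ and $w^h\overset{\mathcal H}{\to}w$ with $v,w\in\mathcal H$, then $\lim_{h\downarrow0}(v^h,w^h)_h=(v,w)$; (A2) if $v^h\overset{\mathcal H}{\to}v$ and $v\in U$, then $\mathcal G^h(v^h)\overset{\mathcal H}{\to}\mathcal G(v)$. Theorem 7 (mesh independence of the BB method). There are constants $\zeta,\lambda_1,\lambda_2>0$, $\theta\in(0,1)$ and an integer $\ell>0$, depending only on $\mathcal F$ and $u^*$, such that the following hold. (i) Every BB sequence $(u_k)$ of $\mathcal G$, with any rule, with $\|u_0-u^*\|<\zeta$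 and $\|u_1-u^*\|<\zeta$ satisfies $\|u_k-u^*\|\le\lambda_1\theta^k\|u_1-u^*\|$ and $\|\mathcal G(u_k)\|\le\lambda_2\theta^k\|\mathcal G(u_1)\|$ for all $k\ge1$. (ii) For every neighbourhood $U$ of $u^*$ there is $\rho\in(0,\zeta]$ such that every BB sequence of $\mathcal G$ with $\|u_0-u^*\|<\rho$ and $\|u_1-u^*\|<\rho$ stays in $U$. (iii) Let $(\mathcal H^h,\mathcal G^h,\mathbb P^h)_{h>0}$ be as above. Let $(u_k)$ be a BB sequence of $\mathcal G$ with some rule such that either $\|u_0-u^*\|<\zeta$ and $\|u_1-u^*\|<\zeta$, or $\mathcal F$ is a strictly convex quadratic function ($\mathcal F(u)=\frac12(\mathcal Au,u)-(b,u)+\gamma$ with $\mathcal A$ bounded, self-adjoint and uniformly positive), $u_0\neq u_1$ being arbitrary in that case. Assume (A1), and (A2) for a neighbourhood $U$ of $u^*$ that contains all $u_k$, $k\ge0$. For each $h>0$ let $(u^h_k)$ be a BB sequence of $\mathcal G^h$ with the same rule, and let $u^h_i\overset{\mathcal H}{\to}u_i$ for $i=0,1$. Then for each $\epsilon>0$ the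 number $k^*(\epsilon)=\min\{k\ge1:\|\mathcal G(u_k)\|<\epsilon\}$ exists, and there is $h_\epsilon>0$ such that for every $h\in(0,h_\epsilon]$ the number $k^*_h(\epsilon)=\min\{k\ge1:\|\mathcal G^h(u^h_k)\|_h<\epsilon\}$ exists and $$k^*(\epsilon)-\ell\le k^*_h(\epsilon)\le k^*(\epsilon).$$ -/

import Mathlib

open Filter Topology

noncomputable section

namespace BB

/-- The two Barzilai-Borwein step-size formulas. -/
inductive StepRule : Type
  | bb1
  | bb2

/-- The step-size `α` computed from `s = u_k - u_{k-1}` and `y = G(u_k) - G(u_{k-1})`: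
`(s, y) / (s, s)` for BB1 and `(y, y) / (s, y)` for BB2. -/
def stepSize {E : Type*} [NormedAddCommGroup E] [InnerProductSpace ℝ E]
    (r : StepRule) (s y : E) : ℝ :=
  match r with
  | StepRule.bb1 => inner ℝ s y / inner ℝ s s
  | StepRule.bb2 => inner ℝ y y / inner ℝ s y

/-- `u` is generated by the BB gradient iteration for the mapping `G` from two distinct initial
iterates `u 0`, `u 1`; `c k` is the formula chosen at step `k`, for `k = 1, 2, …`.
The index is shifted: the equation for `u (k + 2)` is step `k + 1`.
When the algorithm stops at `k`, i.e. `G (u k) = 0`, the recursion continues the finite sequence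
by `u j = u k` for `j ≥ k`, whatever the step-sizes are. -/
structure IsBBSequence {E : Type*} [NormedAddCommGroup E] [InnerProductSpace ℝ E]
    (G : E → E) (c : ℕ → StepRule) (u : ℕ → E) : Prop where
  init_ne : u 1 ≠ u 0
  step : ∀ k : ℕ, u (k + 2) = u (k + 1) -
    (1 / stepSize (c (k + 1)) (u (k + 1) - u k) (G (u (k + 1)) - G (u k))) • G (u (k + 1))

/-- `K` is the smallest index `k ≥ 1` with `‖G (u k)‖ < ε`. -/
def IsStopIndex {E : Type*} [NormedAddCommGroup E] (G : E → E) (u : ℕ → E) (ε : ℝ) (K : ℕ) :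
    Prop :=
  IsLeast {k : ℕ | 1 ≤ k ∧ ‖G (u k)‖ < ε} K

section Continuous

variable {H : Type*} [NormedAddCommGroup H] [InnerProductSpace ℝ H]

/-- The hypotheses of the local convergence theorem: `F` is `C²` with locally Lipschitz second
derivative, `uStar` is a local minimizer, and `F''(uStar)` is bounded and uniformly positive with
constants `0 < δinf ≤ δsup`. -/
structure LocalAssumptions (F : H → ℝ) (uStar : H) (δinf δsup : ℝ) : Prop where
  contDiff : ContDiff ℝ 2 F
  lipschitz : LocallyLipschitz (fderiv ℝ (fderiv ℝ F))
  localMin : IsLocalMin F uStar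
  δinf_pos : 0 < δinf
  δinf_le : δinf ≤ δsup
  lower : ∀ v : H, δinf * ‖v‖ ^ 2 ≤ fderiv ℝ (fderiv ℝ F) uStar v v
  upper : ∀ v : H, fderiv ℝ (fderiv ℝ F) uStar v v ≤ δsup * ‖v‖ ^ 2

/-- `F` is a strictly convex quadratic function: `F(u) = (A u, u) / 2 - (b, u) + γ` with `A`
bounded, self-adjoint (symmetric) and uniformly positive. -/
def IsStrictlyConvexQuadratic (F : H → ℝ) : Prop :=
  ∃ (A : H →L[ℝ] H) (b : H) (γ : ℝ),
    (∀ v w : H, inner ℝ (A v) w = inner ℝ v (A w)) ∧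
    (∃ δ : ℝ, 0 < δ ∧ ∀ v : H, δ * ‖v‖ ^ 2 ≤ inner ℝ (A v) v) ∧
    ∀ u : H, F u = 1 / 2 * inner ℝ (A u) u - inner ℝ b u + γ

end Continuous

section Discrete

/- The family of discrete spaces is indexed by real numbers; only the members with `h > 0` are ever
used. -/
variable {H : Type*} [NormedAddCommGroup H] [InnerProductSpace ℝ H]
  {Hh : ℝ → Type*} [∀ h, NormedAddCommGroup (Hh h)] [∀ h, InnerProductSpace ℝ (Hh h)]

/-- `v h ∈ Hh h` is `H`-convergent to `x`: `‖P h (v h) - x‖ → 0` as `h ↓ 0`. -/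
def HConverges (P : ∀ h, Hh h →ₗ[ℝ] H) (v : ∀ h, Hh h) (x : H) : Prop :=
  Tendsto (fun h : ℝ => ‖P h (v h) - x‖) (𝓝[>] 0) (𝓝 0)

/-- The discrete inner products converge to the inner product of `H` along `H`-convergent
families. -/
def InnerConsistent (P : ∀ h, Hh h →ₗ[ℝ] H) : Prop :=
  ∀ (v w : ∀ h, Hh h) (x z : H), HConverges P v x → HConverges P w z →
    Tendsto (fun h : ℝ => (inner ℝ (v h) (w h) : ℝ)) (𝓝[>] 0) (𝓝 (inner ℝ x z))

/-- Consistency of the discrete mappings `Gh` with `G` at the points of `U`. -/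
def GradientConsistentOn (P : ∀ h, Hh h →ₗ[ℝ] H) (Gh : ∀ h, Hh h → Hh h) (G : H → H)
    (U : Set H) : Prop :=
  ∀ (v : ∀ h, Hh h) (x : H), x ∈ U → HConverges P v x →
    HConverges P (fun h => Gh h (v h)) (G x)

end Discrete

end BB

end

/-! Let T be the Hessian at `uStar` and g_k the gradients. Near `uStar`, g_{k+1} is close to (1 -
T/α_k) g_k. Since s_k = -g_k/α_k, the BB1 value α_{k+1} is nearly the Rayleigh quotient of T at the
previous gradient g_k, and the BB2 value is at least the BB1 value by Cauchy–Schwarz. The decay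
argument uses only this delayed lower bound and two-sided bounds on α_k, so any mixture of the rules
is allowed.

Suppose the gradient norm is not halved for a long time. Once the components of g_k on eigenvalues
below t are negligible, α_{k+1} is at least 5t/6, and 1 - λ/α_{k+1} contracts every component with λ
< 5t/4. The negligible part of the spectrum thus grows by the factor 5/4 in boundedly many steps
until it is everything, a contradiction (`exists_lowSpectrum_small`). The number of steps does not
depend on the dimension, so compressing T to the span of finitely many vectors settles the general
case (`exists_norm_le_half`). Repeated halving and bounded growth in between give R-linear decay
from every starting index (`exists_gradient_le_pow`), which in turn keeps the iterates near `uStar`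
(`NearlyLinear.mem_ball`).

For mesh independence, only the finitely many iterates up to the stopping index K matter, and the
discrete ones converge to them. The strict inequality at K survives for small h. If k + ℓ < K and C
θ^ℓ < 1, decay makes the gradient norm at k strictly larger than ε, which also survives
(`exists_stopIndex_of_consistent`). -/

namespace BB

/-! ### Perturbed gradient iterations in diagonal coordinates -/

/-- `n` steps of a gradient iteration `x (k + 1) = (1 - lam / a k) x k` in diagonal coordinates, with
an error of size `η` in every step, whose inverse step-sizes `a (k + 1)` are bounded below by the
Rayleigh quotients at `x k` up to `m / 12`. -/
structure DiagonalRun (m M η : ℝ) (n : ℕ) {d : ℕ} (lam : Fin d → ℝ) (x : ℕ → Fin d → ℝ)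
    (a : ℕ → ℝ) : Prop where
  lam_ge : ∀ i, m ≤ lam i
  lam_le : ∀ i, lam i ≤ M
  init : ∑ i, x 0 i ^ 2 ≤ 1
  a_ge : ∀ k < n, m / 2 ≤ a k
  a_le : ∀ k < n, a k ≤ M
  rayleigh : ∀ k, k + 1 < n → ∑ i, lam i * x k i ^ 2 ≤ (a (k + 1) + m / 12) * ∑ i, x k i ^ 2
  error : ∀ k < n, ∑ i, (x (k + 1) i - (1 - lam i / a k) * x k i) ^ 2 ≤ η ^ 2

/-- Convexity of the square, applied to ρ · (c x / ρ) + (1 - ρ) · (r / (1 - ρ)). -/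
lemma one_sub_mul_sq_add_le {ρ c x r : ℝ} (h0 : 0 < ρ) (h1 : ρ < 1) (hc : |c| ≤ ρ) :
    (c * x + r) ^ 2 ≤ ρ * x ^ 2 + r ^ 2 / (1 - ρ) := by
  have hc2 : c ^ 2 ≤ ρ ^ 2 := by
    rw [← sq_abs c]; exact pow_le_pow_left₀ (abs_nonneg c) hc 2
  have h2 : 0 < 1 - ρ := by linarith
  have key : 0 ≤ ρ * ((1 - ρ) * ρ * x ^ 2 + r ^ 2 - (1 - ρ) * (c * x + r) ^ 2) := by
    have e1 := sq_nonneg (ρ * (1 - ρ) * x - c * r)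
    have e2 := mul_nonneg (sub_nonneg.2 hc2) (sq_nonneg r)
    have e3 := mul_nonneg (mul_nonneg (mul_nonneg h0.le h2.le) (sub_nonneg.2 hc2)) (sq_nonneg x)
    nlinarith
  have key2 := nonneg_of_mul_nonneg_right key h0
  have : ρ * x ^ 2 + r ^ 2 / (1 - ρ) = ((1 - ρ) * ρ * x ^ 2 + r ^ 2) / (1 - ρ) := by
    field_simp
  rw [this, le_div_iff₀ h2]
  linarith

lemma sum_sq_add_le {ι : Type*} (s : Finset ι) {ρ η : ℝ} (h0 : 0 < ρ) (h1 : ρ < 1)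
    (c x y : ι → ℝ) (hc : ∀ i ∈ s, |c i| ≤ ρ) (hy : ∑ i ∈ s, (y i - c i * x i) ^ 2 ≤ η ^ 2) :
    ∑ i ∈ s, y i ^ 2 ≤ ρ * ∑ i ∈ s, x i ^ 2 + η ^ 2 / (1 - ρ) := by
  calc ∑ i ∈ s, y i ^ 2 ≤ ∑ i ∈ s, (ρ * x i ^ 2 + (y i - c i * x i) ^ 2 / (1 - ρ)) := by
        refine Finset.sum_le_sum fun i hi => ?_
        have := one_sub_mul_sq_add_le (x := x i) (r := y i - c i * x i) h0 h1 (hc i hi)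
        simpa using this
    _ = ρ * ∑ i ∈ s, x i ^ 2 + (∑ i ∈ s, (y i - c i * x i) ^ 2) / (1 - ρ) := by
        rw [Finset.sum_add_distrib, Finset.mul_sum, Finset.sum_div]
    _ ≤ _ := by
        have : 0 < 1 - ρ := by linarith
        gcongr

lemma le_pow_mul_add_of_affine_le {ρ b B : ℝ} {z : ℕ → ℝ} {N n : ℕ} (h0 : 0 < ρ) (h1 : ρ < 1)
    (hb : 0 ≤ b) (hB : z N ≤ B) (hz : ∀ k, N ≤ k → k < n → z (k + 1) ≤ ρ * z k + b) (p : ℕ)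
    (hp : N + p ≤ n) : z (N + p) ≤ ρ ^ p * B + b / (1 - ρ) := by
  have h2 : 0 < 1 - ρ := by linarith
  induction p with
  | zero => simpa using hB.trans (le_add_of_nonneg_right (div_nonneg hb h2.le))
  | succ p ih =>
    have h3 := hz (N + p) (by omega) (by omega)
    have h4 := mul_le_mul_of_nonneg_left (ih (by omega)) h0.le
    have h5 : ρ * (b / (1 - ρ)) + b = b / (1 - ρ) := by field_simp; ring
    rw [← add_assoc, pow_succ]
    linarith

namespace DiagonalRun

variable {m M η : ℝ} {n d : ℕ} {lam : Fin d → ℝ} {x : ℕ → Fin d → ℝ} {a : ℕ → ℝ}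

lemma mono {η' : ℝ} (h : DiagonalRun m M η n lam x a) (h0 : 0 ≤ η) (hη : η ≤ η') :
    DiagonalRun m M η' n lam x a :=
  { h with error := fun k hk => (h.error k hk).trans (by gcongr) }

lemma sum_sq_le (h : DiagonalRun m M η n lam x a) (hm : 0 < m) (h0 : 0 ≤ η) (hη : η ≤ 1) :
    ∀ k ≤ n, ∑ i, x k i ^ 2 ≤ (2 * (1 + 2 * M / m) ^ 2 + 2) ^ k := by
  set L := 1 + 2 * M / m
  intro k
  induction k with
  | zero => intro _; simpa using h.init
  | succ k ih =>
    intro hk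
    have hk' : k < n := hk
    have h1 := ih hk'.le
    have ha := h.a_ge k hk'
    have ha0 : 0 < a k := by linarith
    have h2 : ∑ i, x (k + 1) i ^ 2 ≤ ∑ i, (2 * L ^ 2 * x k i ^ 2 +
        2 * (x (k + 1) i - (1 - lam i / a k) * x k i) ^ 2) := by
      refine Finset.sum_le_sum fun i _ => ?_
      have hl := h.lam_ge i
      have hq : lam i / a k ≤ 2 * M / m := by
        rw [div_le_div_iff₀ ha0 hm]
        nlinarith [h.lam_le i]
      have hq0 : 0 ≤ lam i / a k := div_nonneg (by linarith) ha0.le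
      have hc : (1 - lam i / a k) ^ 2 ≤ L ^ 2 := by
        apply sq_le_sq'
        · simp only [L]; linarith
        · simp only [L]; linarith
      have := mul_le_mul_of_nonneg_right hc (sq_nonneg (x k i))
      nlinarith [sq_nonneg (x (k + 1) i - 2 * ((1 - lam i / a k) * x k i))]
    rw [Finset.sum_add_distrib, ← Finset.mul_sum, ← Finset.mul_sum] at h2
    have h3 := h.error k hk'
    have h4 : η ^ 2 ≤ 1 := pow_le_one₀ h0 hη
    have h5 : (1 : ℝ) ≤ (2 * L ^ 2 + 2) ^ k := one_le_pow₀ (by nlinarith [sq_nonneg L])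
    have h6 := mul_le_mul_of_nonneg_left h1 (by positivity : 0 ≤ 2 * L ^ 2)
    rw [pow_succ]
    linarith

/-- A small inverse step-size forces the iterate to be concentrated on small eigenvalues. -/
lemma sum_sq_le_of_lt (h : DiagonalRun m M η n lam x a) (hm : 0 < m) {t : ℝ} (ht : m ≤ t)
    {k : ℕ} (hk : k + 1 < n) (ha : a (k + 1) < 2 / 3 * (t * (5 / 4))) :
    ∑ i, x k i ^ 2 ≤ 12 * ∑ i with lam i < t, x k i ^ 2 := by
  have h1 := h.rayleigh k hk
  have hsplit := Finset.sum_filter_add_sum_filter_not Finset.univ (fun i => lam i < t)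
    (fun i => x k i ^ 2)
  have h2 : t * ∑ i with ¬ lam i < t, x k i ^ 2 ≤ ∑ i, lam i * x k i ^ 2 := by
    rw [Finset.mul_sum]
    calc ∑ i with ¬ lam i < t, t * x k i ^ 2 ≤ ∑ i with ¬ lam i < t, lam i * x k i ^ 2 := by
          refine Finset.sum_le_sum fun i hi => ?_
          have : t ≤ lam i := not_lt.1 (Finset.mem_filter.1 hi).2
          gcongr
      _ ≤ _ := by
          refine Finset.sum_le_sum_of_subset_of_nonneg (Finset.filter_subset _ _) fun i _ _ => ?_
          have : 0 ≤ lam i := hm.le.trans (h.lam_ge i)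
          positivity
  have h3 : (a (k + 1) + m / 12) * ∑ i, x k i ^ 2 ≤ 11 / 12 * t * ∑ i, x k i ^ 2 := by
    refine mul_le_mul_of_nonneg_right ?_ (Finset.sum_nonneg fun i _ => sq_nonneg _)
    linarith
  have ht0 : 0 < t := by linarith
  have h4 : ∑ i with ¬ lam i < t, x k i ^ 2 ≤ 11 / 12 * ∑ i, x k i ^ 2 := by
    refine le_of_mul_le_mul_left ?_ ht0
    linarith
  linarith

end DiagonalRun

/-- Induction on the spectral threshold, with `N` and `η` independent of the dimension. Small mass
below t forces large inverse step-sizes, and these damp all components below 5t/4. -/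
lemma exists_lowSpectrum_small {m M : ℝ} (hm : 0 < m) (hM : m ≤ M) (j : ℕ) :
    ∃ (N : ℕ) (η : ℝ), 0 < η ∧ η ≤ 1 ∧ ∀ (n d : ℕ) (lam : Fin d → ℝ) (x : ℕ → Fin d → ℝ)
      (a : ℕ → ℝ), DiagonalRun m M η n lam x a → (∀ k ≤ n, 1 / 4 ≤ ∑ i, x k i ^ 2) →
      ∀ k, N ≤ k → k ≤ n → ∑ i with lam i < m * (5 / 4) ^ j, x k i ^ 2 ≤ 1 / 60 := by
  induction j with
  | zero =>
    refine ⟨0, 1, one_pos, le_rfl, fun n d lam x a h _ k _ _ => ?_⟩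
    rw [Finset.sum_eq_zero]
    · norm_num
    · intro i hi
      have := (Finset.mem_filter.1 hi).2
      have := h.lam_ge i
      simp at *
      linarith
  | succ j ih =>
    obtain ⟨N, η₀, hη₀, hη₀1, hN⟩ := ih
    have hM0 : 0 < M := hm.trans_le hM
    -- The factor 1 - λ/a is at least -1/2 when λ/a ≤ 3/2, and at most 1 - m/M because λ ≥ m and a ≤
    -- M.
    set ρ : ℝ := max (1 / 2) (1 - m / M) with hρ
    have hρ0 : 0 < ρ := lt_max_of_lt_left (by norm_num)
    have hρ1 : ρ < 1 := max_lt (by norm_num) (by have := div_pos hm hM0; linarith)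
    have hρ2 : 0 < 1 - ρ := by linarith
    set D : ℝ := 2 * (1 + 2 * M / m) ^ 2 + 2 with hD
    have hD0 : 0 < D := by positivity
    -- The final bound 1/60 is split evenly: `p` damps the mass present at step `N + 1` to 1/120,
    -- and η ≤ (1 - ρ)/11 keeps the accumulated errors below 1/121.
    obtain ⟨p, hp⟩ := exists_pow_lt_of_lt_one
      (show 0 < 1 / 120 / D ^ (N + 1) by positivity) hρ1
    rw [lt_div_iff₀ (by positivity)] at hp
    refine ⟨N + 1 + p, min η₀ ((1 - ρ) / 11), lt_min hη₀ (by positivity),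
      (min_le_left _ _).trans hη₀1, fun n d lam x a h hx k hk hkn => ?_⟩
    set η := min η₀ ((1 - ρ) / 11) with hη
    have hη0 : 0 < η := lt_min hη₀ (by positivity)
    have hη1 : η ≤ 1 := (min_le_left _ _).trans hη₀1
    have hlow := hN n d lam x a (h.mono hη0.le (min_le_left _ _)) hx
    set t := m * (5 / 4) ^ j with ht
    have htm : m ≤ t := le_mul_of_one_le_right hm.le (one_le_pow₀ (by norm_num))
    -- Otherwise the total mass would be at most 12 · 1/60 = 1/5, below the assumed 1/4.
    have hta : ∀ k, N ≤ k → k + 1 < n → 2 / 3 * (t * (5 / 4)) ≤ a (k + 1) := by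
      intro k hk hkn
      by_contra! hlt
      have h1 := h.sum_sq_le_of_lt hm htm hkn hlt
      have h2 := hlow k hk (by omega)
      have h3 := hx k (by omega)
      linarith
    rw [pow_succ, ← mul_assoc, ← ht]
    have hstep : ∀ k, N + 1 ≤ k → k < n → ∑ i with lam i < t * (5 / 4), x (k + 1) i ^ 2 ≤
        ρ * ∑ i with lam i < t * (5 / 4), x k i ^ 2 + η ^ 2 / (1 - ρ) := by
      intro k hk hkn
      obtain ⟨k, rfl⟩ : ∃ k', k = k' + 1 := ⟨k - 1, by omega⟩
      have hak := hta k (by omega) hkn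
      have hak0 : 0 < a (k + 1) := by linarith
      refine sum_sq_add_le _ hρ0 hρ1 (fun i => 1 - lam i / a (k + 1)) _ _ (fun i hi => ?_) ?_
      · have hi : lam i < t * (5 / 4) := (Finset.mem_filter.1 hi).2
        have h1 : lam i / a (k + 1) ≤ 3 / 2 := by
          rw [div_le_iff₀ hak0]; linarith
        have h2 : m / M ≤ lam i / a (k + 1) := by
          have := h.lam_ge i
          have := h.a_le _ hkn
          gcongr
          linarith
        rw [abs_le]
        exact ⟨by linarith [le_max_left (1 / 2) (1 - m / M)],
          by linarith [le_max_right (1 / 2) (1 - m / M)]⟩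
      · exact (Finset.sum_le_sum_of_subset_of_nonneg (Finset.filter_subset _ _)
          fun i _ _ => sq_nonneg _).trans (h.error _ hkn)
    obtain ⟨p', rfl⟩ := Nat.exists_eq_add_of_le (show N + 1 ≤ k by omega)
    have hinit : ∑ i with lam i < t * (5 / 4), x (N + 1) i ^ 2 ≤ D ^ (N + 1) :=
      (Finset.sum_le_sum_of_subset_of_nonneg (Finset.filter_subset _ _)
        fun i _ _ => sq_nonneg _).trans (h.sum_sq_le hm hη0.le hη1 _ (by omega))
    have hfin := le_pow_mul_add_of_affine_le (z := fun k => ∑ i with lam i < t * (5 / 4), x k i ^ 2)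
      hρ0 hρ1 (by positivity) hinit hstep p' hkn
    have h3 : ρ ^ p' ≤ ρ ^ p := pow_le_pow_of_le_one hρ0.le hρ1.le (by omega)
    have h4 : ρ ^ p' * D ^ (N + 1) ≤ ρ ^ p * D ^ (N + 1) := by gcongr
    have h5 : η ^ 2 / (1 - ρ) / (1 - ρ) ≤ 1 / 120 := by
      have : η ^ 2 ≤ ((1 - ρ) / 11) ^ 2 := by
        have := min_le_right η₀ ((1 - ρ) / 11)
        gcongr
      rw [div_div, div_le_iff₀ (by positivity)]
      nlinarith [sq_nonneg (1 - ρ)]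
    linarith

theorem exists_sum_sq_lt_of_diagonalRun {m M : ℝ} (hm : 0 < m) (hM : m ≤ M) :
    ∃ (n : ℕ) (η : ℝ), 0 < η ∧ ∀ (d : ℕ) (lam : Fin d → ℝ) (x : ℕ → Fin d → ℝ)
      (a : ℕ → ℝ), DiagonalRun m M η n lam x a → ∃ k ≤ n, ∑ i, x k i ^ 2 < 1 / 4 := by
  -- With this `j` the threshold exceeds M, so the low part is the whole vector and 1/60 contradicts
  -- 1/4.
  obtain ⟨j, hj⟩ := pow_unbounded_of_one_lt (M / m) (show (1 : ℝ) < 5 / 4 by norm_num)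
  obtain ⟨N, η, hη, -, hN⟩ := exists_lowSpectrum_small hm hM j
  refine ⟨N, η, hη, fun d lam x a h => ?_⟩
  by_contra! hx
  have h1 := hN N d lam x a h hx N le_rfl le_rfl
  rw [Finset.filter_true_of_mem] at h1
  · linarith [hx N le_rfl]
  · intro i _
    rw [div_lt_iff₀ hm] at hj
    linarith [h.lam_le i]

/-! ### Reduction of the operator iteration to diagonal coordinates -/

section Compression

variable {H : Type*} [NormedAddCommGroup H] [InnerProductSpace ℝ H]

/-- Diagonalization of the compression of a symmetric operator to a finite-dimensional subspace. -/
lemma exists_diagonalization_compression (T : H →L[ℝ] H)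
    (hT : ∀ v w, inner ℝ (T v) w = inner ℝ v (T w)) (V : Submodule ℝ H) [FiniteDimensional ℝ V] :
    ∃ (d : ℕ) (lam : Fin d → ℝ) (b : Fin d → H), (∀ i, ‖b i‖ = 1) ∧
      (∀ i, lam i = inner ℝ (T (b i)) (b i)) ∧
      (∀ v ∈ V, ∑ i, inner ℝ (b i) v ^ 2 = ‖v‖ ^ 2) ∧
      (∀ v ∈ V, ∀ i, inner ℝ (b i) (T v) = lam i * inner ℝ (b i) v) ∧
      (∀ v ∈ V, inner ℝ (T v) v = ∑ i, lam i * inner ℝ (b i) v ^ 2) := by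
  set S : V →ₗ[ℝ] V := (V.orthogonalProjectionOnto ∘L T ∘L V.subtypeL).toLinearMap with hS
  have hS1 : ∀ v w : V, inner ℝ (S v) w = inner ℝ (T v) (w : H) := fun v w => by
    simp [hS]
  have hS2 : ∀ v w : V, inner ℝ w (S v) = inner ℝ (w : H) (T v) := fun v w => by
    rw [real_inner_comm, hS1, real_inner_comm]
  have hsymm : S.IsSymmetric := fun v w => by rw [hS1, hS2, hT]
  set b := hsymm.eigenvectorBasis rfl
  have hb : ∀ (i) (v : V), inner ℝ (b i : H) (T v) =
      hsymm.eigenvalues rfl i * inner ℝ (b i : H) (v : H) := fun i v => by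
    rw [← hS2, ← hsymm, hsymm.apply_eigenvectorBasis]
    simp [inner_smul_left, b]
  have hnorm : ∀ i, ‖(b i : H)‖ = 1 := fun i => b.orthonormal.1 i
  refine ⟨_, hsymm.eigenvalues rfl, fun i => b i, hnorm, fun i => ?_, fun v hv => ?_,
    fun v hv i => hb i ⟨v, hv⟩, fun v hv => ?_⟩
  · rw [real_inner_comm, hb, real_inner_self_eq_norm_sq, hnorm]; simp
  · have := b.sum_sq_norm_inner_right ⟨v, hv⟩
    simpa using this
  · have h1 := b.sum_inner_mul_inner (S ⟨v, hv⟩) ⟨v, hv⟩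
    rw [hS1] at h1
    rw [← h1]
    refine Finset.sum_congr rfl fun i _ => ?_
    rw [real_inner_comm, hS2, hb]
    simp
    ring

/-- A gradient iteration for a uniformly positive symmetric operator whose inverse step-sizes are
almost bounded below by the preceding Rayleigh quotients halves the norm within `n` steps; `n` and
the admissible relative error `η` depend only on the spectral bounds. -/
theorem exists_norm_le_half {m M : ℝ} (hm : 0 < m) (hM : m ≤ M) :
    ∃ (n : ℕ) (η : ℝ), 0 < η ∧ ∀ (T : H →L[ℝ] H) (g : ℕ → H) (a : ℕ → ℝ),
      (∀ v w, inner ℝ (T v) w = inner ℝ v (T w)) →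
      (∀ v, m * ‖v‖ ^ 2 ≤ inner ℝ (T v) v) → ‖T‖ ≤ M →
      (∀ k < n, m / 2 ≤ a k) → (∀ k < n, a k ≤ M) →
      (∀ k, k + 1 < n → inner ℝ (T (g k)) (g k) ≤ (a (k + 1) + m / 12) * ‖g k‖ ^ 2) →
      (∀ k < n, ‖g (k + 1) - (g k - (1 / a k) • T (g k))‖ ≤ η * ‖g k‖) →
      ∃ j ≤ n, ‖g j‖ ≤ 1 / 2 * ‖g 0‖ := by
  obtain ⟨n, η, hη, hn⟩ := exists_sum_sq_lt_of_diagonalRun hm hM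
  have hM0 : 0 < M := hm.trans_le hM
  set D : ℝ := 2 + 2 * M / m with hD
  have hD1 : 1 ≤ D := by have : 0 ≤ 2 * M / m := by positivity
                         linarith
  have hDn : 1 ≤ D ^ n := one_le_pow₀ hD1
  -- Errors here are relative to `g k`, but the diagonal run measures them against `g 0`; the growth
  -- bound D ^ n converts one into the other, and the cap 1 makes that growth bound valid.
  refine ⟨n, min 1 (η / D ^ n), by positivity, fun T g a hT hTm hTM ha haM hR herr => ?_⟩
  rcases eq_or_ne (g 0) 0 with h0 | h0
  · exact ⟨0, n.zero_le, by simp [h0]⟩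
  have hg0 : 0 < ‖g 0‖ := norm_pos_iff.2 h0
  have hgrow : ∀ k ≤ n, ‖g k‖ ≤ D ^ k * ‖g 0‖ := by
    intro k
    induction k with
    | zero => simp
    | succ k ih =>
      intro hk
      have h1 := ih (by omega)
      have h2 := herr k hk
      have h3 := ha k hk
      have h4 : 0 < a k := by linarith
      have h5 : ‖g (k + 1)‖ ≤ ‖g (k + 1) - (g k - (1 / a k) • T (g k))‖ + ‖g k‖ +
          ‖(1 / a k) • T (g k)‖ := by
        calc ‖g (k + 1)‖ = ‖(g (k + 1) - (g k - (1 / a k) • T (g k))) + g k -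
              (1 / a k) • T (g k)‖ := by congr 1; abel
          _ ≤ _ := (norm_sub_le _ _).trans (by gcongr; exact norm_add_le _ _)
      have h6 : ‖(1 / a k) • T (g k)‖ ≤ 2 * M / m * ‖g k‖ := by
        rw [norm_smul, Real.norm_of_nonneg (by positivity)]
        calc 1 / a k * ‖T (g k)‖ ≤ 1 / (m / 2) * (M * ‖g k‖) := by
              gcongr
              exact T.le_of_opNorm_le hTM _
          _ = _ := by field_simp
      have h7 : min 1 (η / D ^ n) * ‖g k‖ ≤ 1 * ‖g k‖ := by
        gcongr; exact min_le_left _ _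
      have h8 : ‖g (k + 1)‖ ≤ D * ‖g k‖ := by rw [hD]; linarith
      calc ‖g (k + 1)‖ ≤ D * ‖g k‖ := h8
        _ ≤ D * (D ^ k * ‖g 0‖) := by gcongr
        _ = _ := by ring
  -- The images under T are included so that the error vectors lie in V and their norms are given
  -- exactly by the coordinates.
  set V : Submodule ℝ H := Submodule.span ℝ
    ((fun k => g k) '' Set.Iic n ∪ (fun k => T (g k)) '' Set.Iic n) with hV
  have : FiniteDimensional ℝ V := FiniteDimensional.span_of_finite ℝ
    (((Set.finite_Iic n).image _).union ((Set.finite_Iic n).image _))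
  have hgV : ∀ k ≤ n, g k ∈ V := fun k hk =>
    Submodule.subset_span (Or.inl ⟨k, hk, rfl⟩)
  have hTgV : ∀ k ≤ n, T (g k) ∈ V := fun k hk =>
    Submodule.subset_span (Or.inr ⟨k, hk, rfl⟩)
  obtain ⟨d, lam, b, hb, hlam, hsq, hTb, hTin⟩ := exists_diagonalization_compression T hT V
  have hsum : ∀ k ≤ n, ∑ i, (inner ℝ (b i) (g k) / ‖g 0‖) ^ 2 = ‖g k‖ ^ 2 / ‖g 0‖ ^ 2 := by
    intro k hk
    simp only [div_pow]
    rw [← Finset.sum_div, hsq _ (hgV k hk)]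
  obtain ⟨k, hk, hlt⟩ := hn d lam (fun k i => inner ℝ (b i) (g k) / ‖g 0‖) a
    { lam_ge := fun i => by
        have := hTm (b i)
        rw [hb] at this
        rw [hlam]; linarith
      lam_le := fun i => by
        rw [hlam]
        refine (real_inner_le_norm _ _).trans ?_
        have := T.le_of_opNorm_le hTM (b i)
        rw [hb] at *
        linarith
      init := by
        rw [hsum 0 (by omega), div_self (by positivity)]
      a_ge := ha
      a_le := haM
      rayleigh := fun k hk => by
        have h1 := hR k hk
        rw [hTin _ (hgV k (by omega))] at h1
        rw [hsum k (by omega)]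
        simp only [div_pow]
        simp_rw [← mul_div_assoc]
        rw [← Finset.sum_div]
        gcongr
      error := fun k hk => by
        have h4 : g (k + 1) - (g k - (1 / a k) • T (g k)) ∈ V :=
          V.sub_mem (hgV _ hk) (V.sub_mem (hgV _ hk.le) (V.smul_mem _ (hTgV _ hk.le)))
        have h5 : ∑ i, (inner ℝ (b i) (g (k + 1)) / ‖g 0‖ -
            (1 - lam i / a k) * (inner ℝ (b i) (g k) / ‖g 0‖)) ^ 2 =
            ‖g (k + 1) - (g k - (1 / a k) • T (g k))‖ ^ 2 / ‖g 0‖ ^ 2 := by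
          rw [← hsq _ h4, Finset.sum_div]
          refine Finset.sum_congr rfl fun i _ => ?_
          rw [inner_sub_right, inner_sub_right, inner_smul_right, hTb _ (hgV _ hk.le)]
          field_simp
        rw [h5, ← div_pow]
        have h6 : ‖g (k + 1) - (g k - (1 / a k) • T (g k))‖ ≤ η * ‖g 0‖ := by
          calc _ ≤ min 1 (η / D ^ n) * ‖g k‖ := herr k hk
            _ ≤ η / D ^ n * (D ^ n * ‖g 0‖) := by
                gcongr
                · exact min_le_right _ _
                · exact (hgrow k hk.le).trans (by gcongr)
            _ = _ := by field_simp
        have h7 : ‖g (k + 1) - (g k - (1 / a k) • T (g k))‖ / ‖g 0‖ ≤ η := by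
          rwa [div_le_iff₀ hg0]
        gcongr }
  refine ⟨k, hk, ?_⟩
  rw [hsum k hk, div_lt_iff₀ (by positivity)] at hlt
  refine le_of_sq_le_sq ?_ (by positivity)
  rw [mul_pow]
  linarith

end Compression

/-! ### R-linear convergence for nearly linear gradients -/

section LocalConvergence

variable {H : Type*} [NormedAddCommGroup H] [InnerProductSpace ℝ H]

/-- `G` vanishes at `uStar` and is, on `W`, an `η`-Lipschitz perturbation of a symmetric operator `T`
with spectral bounds `m` and `M`. -/
structure NearlyLinear (G : H → H) (uStar : H) (T : H →L[ℝ] H) (m M η : ℝ) (W : Set H) : Prop where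
  symm : ∀ v w, inner ℝ (T v) w = inner ℝ v (T w)
  coercive : ∀ v, m * ‖v‖ ^ 2 ≤ inner ℝ (T v) v
  opNorm_le : ‖T‖ ≤ M
  mem : uStar ∈ W
  zero : G uStar = 0
  approx : ∀ x ∈ W, ∀ y ∈ W, ‖G x - G y - T (x - y)‖ ≤ η * ‖x - y‖

namespace NearlyLinear

variable {G : H → H} {uStar : H} {T : H →L[ℝ] H} {m M η : ℝ} {W : Set H} {c : ℕ → StepRule}
  {u : ℕ → H}

lemma mono {W' : Set H} (h : NearlyLinear G uStar T m M η W) (hW : W' ⊆ W) (hu : uStar ∈ W') :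
    NearlyLinear G uStar T m M η W' :=
  { h with
    mem := hu
    approx := fun x hx y hy => h.approx x (hW hx) y (hW hy) }

lemma inner_map_le (h : NearlyLinear G uStar T m M η W) {x y : H} (hx : x ∈ W) (hy : y ∈ W) :
    inner ℝ (T (x - y)) (x - y) ≤ inner ℝ (x - y) (G x - G y) + η * ‖x - y‖ ^ 2 := by
  have h1 := h.approx x hx y hy
  have h2 := real_inner_le_norm (x - y) (-(G x - G y - T (x - y)))
  rw [norm_neg, inner_neg_right, inner_sub_right, real_inner_comm (T (x - y))] at h2
  have h3 := mul_le_mul_of_nonneg_left h1 (norm_nonneg (x - y))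
  nlinarith

lemma le_inner (h : NearlyLinear G uStar T m M η W) (hη : η ≤ m / 2) {x y : H} (hx : x ∈ W)
    (hy : y ∈ W) : m / 2 * ‖x - y‖ ^ 2 ≤ inner ℝ (x - y) (G x - G y) := by
  have h1 := h.inner_map_le hx hy
  have h2 := h.coercive (x - y)
  have h3 := mul_le_mul_of_nonneg_right hη (sq_nonneg ‖x - y‖)
  linarith

lemma norm_sub_le (h : NearlyLinear G uStar T m M η W) (hη : η ≤ M) {x y : H} (hx : x ∈ W)
    (hy : y ∈ W) : ‖G x - G y‖ ≤ 2 * M * ‖x - y‖ := by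
  have h1 := h.approx x hx y hy
  have h2 : ‖G x - G y‖ ≤ ‖G x - G y - T (x - y)‖ + ‖T (x - y)‖ := by
    simpa using norm_add_le (G x - G y - T (x - y)) (T (x - y))
  have h3 := T.le_of_opNorm_le h.opNorm_le (x - y)
  have h4 := mul_le_mul_of_nonneg_right hη (norm_nonneg (x - y))
  linarith

lemma le_norm_sub (h : NearlyLinear G uStar T m M η W) (hη : η ≤ m / 2) {x y : H} (hx : x ∈ W)
    (hy : y ∈ W) : m / 2 * ‖x - y‖ ≤ ‖G x - G y‖ := by
  rcases eq_or_ne (x - y) 0 with h0 | h0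
  · simp [h0]
  · have h1 := (h.le_inner hη hx hy).trans (real_inner_le_norm _ _)
    refine le_of_mul_le_mul_left ?_ (norm_pos_iff.2 h0)
    linarith

lemma norm_error_le (h : NearlyLinear G uStar T m M η W) (hm : 0 < m) (hη : η ≤ m / 2) {x : H}
    (hx : x ∈ W) : ‖x - uStar‖ ≤ 2 / m * ‖G x‖ := by
  have := h.le_norm_sub hη hx h.mem
  rw [h.zero, sub_zero] at this
  rw [div_mul_eq_mul_div, le_div_iff₀ hm]
  linarith

lemma norm_le (h : NearlyLinear G uStar T m M η W) (hη : η ≤ M) {x : H} (hx : x ∈ W) :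
    ‖G x‖ ≤ 2 * M * ‖x - uStar‖ := by
  simpa [h.zero] using h.norm_sub_le hη hx h.mem

/-- The inverse step-size of either rule is at least the Rayleigh quotient up to `η`. -/
lemma rayleigh_le_stepSize (h : NearlyLinear G uStar T m M η W) (hm : 0 < m) (hη : η ≤ m / 2)
    {x y : H} (hx : x ∈ W) (hy : y ∈ W) (hxy : x ≠ y) (r : StepRule) :
    inner ℝ (T (x - y)) (x - y) ≤ (stepSize r (x - y) (G x - G y) + η) * ‖x - y‖ ^ 2 := by
  have hs : 0 < ‖x - y‖ := norm_pos_iff.2 (sub_ne_zero.2 hxy)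
  have h1 := h.inner_map_le hx hy
  have h2 := h.le_inner hη hx hy
  have h3 : 0 < inner ℝ (x - y) (G x - G y) := lt_of_lt_of_le (by positivity) h2
  suffices inner ℝ (x - y) (G x - G y) ≤ stepSize r (x - y) (G x - G y) * ‖x - y‖ ^ 2 by linarith
  cases r with
  | bb1 =>
    rw [stepSize, real_inner_self_eq_norm_sq, div_mul_cancel₀ _ (by positivity)]
  | bb2 =>
    rw [stepSize, real_inner_self_eq_norm_sq, div_mul_eq_mul_div, le_div_iff₀ h3, ← mul_pow, ← sq]
    have := real_inner_le_norm (x - y) (G x - G y)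
    rw [mul_comm ‖x - y‖] at this
    gcongr

lemma le_stepSize (h : NearlyLinear G uStar T m M η W) (hm : 0 < m) (hη : η ≤ m / 2)
    {x y : H} (hx : x ∈ W) (hy : y ∈ W) (hxy : x ≠ y) (r : StepRule) :
    m / 2 ≤ stepSize r (x - y) (G x - G y) := by
  have hs : 0 < ‖x - y‖ := norm_pos_iff.2 (sub_ne_zero.2 hxy)
  have h1 := (h.coercive _).trans (h.rayleigh_le_stepSize hm hη hx hy hxy r)
  have := le_of_mul_le_mul_right h1 (by positivity)
  linarith

lemma stepSize_le (h : NearlyLinear G uStar T m M η W) (hm : 0 < m) (hM : m ≤ M) (hη : η ≤ m / 2)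
    {x y : H} (hx : x ∈ W) (hy : y ∈ W) (hxy : x ≠ y) (r : StepRule) :
    stepSize r (x - y) (G x - G y) ≤ 8 * M ^ 2 / m := by
  have hs : 0 < ‖x - y‖ := norm_pos_iff.2 (sub_ne_zero.2 hxy)
  have h1 := h.norm_sub_le (by linarith) hx hy
  have h2 := h.le_inner hη hx hy
  have h3 : 0 < inner ℝ (x - y) (G x - G y) := lt_of_lt_of_le (by positivity) h2
  have hM0 : 0 < M := hm.trans_le hM
  cases r with
  | bb1 =>
    rw [stepSize, real_inner_self_eq_norm_sq]
    calc inner ℝ (x - y) (G x - G y) / ‖x - y‖ ^ 2 ≤ ‖x - y‖ * (2 * M * ‖x - y‖) / ‖x - y‖ ^ 2 := by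
          gcongr
          exact (real_inner_le_norm _ _).trans (by gcongr)
      _ = 2 * M := by field_simp
      _ ≤ 8 * M ^ 2 / m := by
          rw [le_div_iff₀ hm]; nlinarith
  | bb2 =>
    rw [stepSize, real_inner_self_eq_norm_sq]
    calc ‖G x - G y‖ ^ 2 / inner ℝ (x - y) (G x - G y)
        ≤ (2 * M * ‖x - y‖) ^ 2 / (m / 2 * ‖x - y‖ ^ 2) := by gcongr
      _ = 8 * M ^ 2 / m := by field_simp; ring

/-- Two consecutive iterates differ as long as the method has not stopped. -/
lemma succ_ne (h : NearlyLinear G uStar T m M η W) (hm : 0 < m) (hη : η ≤ m / 2)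
    (hu : IsBBSequence G c u) {K : ℕ} (hW : ∀ i ≤ K, u i ∈ W) (k : ℕ) (hk : k + 1 ≤ K)
    (hG : G (u (k + 1)) ≠ 0) : u (k + 1) ≠ u k := by
  induction k with
  | zero => exact hu.init_ne
  | succ k ih =>
    intro heq
    rw [heq] at hG
    have h1 := h.le_stepSize hm hη (hW (k + 1) (by omega)) (hW k (by omega)) (ih (by omega) hG)
      (c (k + 1))
    rw [hu.step, sub_eq_self, smul_eq_zero] at heq
    rcases heq with h2 | h2
    · have : 0 < 1 / stepSize (c (k + 1)) (u (k + 1) - u k) (G (u (k + 1)) - G (u k)) :=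
        one_div_pos.2 (by linarith)
      exact this.ne' h2
    · exact hG h2

lemma norm_step_le (h : NearlyLinear G uStar T m M η W) (hm : 0 < m) (hη : η ≤ m / 2)
    (hu : IsBBSequence G c u) {k : ℕ} (h0 : u k ∈ W) (h1 : u (k + 1) ∈ W) :
    ‖u (k + 2) - u (k + 1)‖ ≤ 2 / m * ‖G (u (k + 1))‖ := by
  rw [hu.step, sub_sub_cancel_left, norm_neg]
  -- For equal iterates the step-size is 0/0 = 0 and 1/0 = 0, so the iteration stands still and the
  -- bound is trivial.
  rcases eq_or_ne (u (k + 1)) (u k) with heq | hne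
  · have : stepSize (c (k + 1)) (0 : H) 0 = 0 := by cases c (k + 1) <;> simp [stepSize]
    rw [heq, sub_self, sub_self, this]
    simp
    positivity
  · have h2 := h.le_stepSize hm hη h1 h0 hne (c (k + 1))
    have h3 : 0 < stepSize (c (k + 1)) (u (k + 1) - u k) (G (u (k + 1)) - G (u k)) := by linarith
    rw [norm_smul, Real.norm_of_nonneg (by positivity)]
    refine mul_le_mul_of_nonneg_right ?_ (norm_nonneg _)
    rw [div_le_div_iff₀ h3 hm]
    linarith

lemma norm_succ_le (h : NearlyLinear G uStar T m M η W) (hm : 0 < m) (hM : m ≤ M) (hη : η ≤ m / 2)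
    (hu : IsBBSequence G c u) {k : ℕ} (h0 : u k ∈ W) (h1 : u (k + 1) ∈ W) (h2 : u (k + 2) ∈ W) :
    ‖G (u (k + 2))‖ ≤ (1 + 4 * M / m) * ‖G (u (k + 1))‖ := by
  have h3 := h.norm_step_le hm hη hu h0 h1
  have h4 := h.norm_sub_le (by linarith) h2 h1
  have h5 : ‖G (u (k + 2))‖ ≤ ‖G (u (k + 2)) - G (u (k + 1))‖ + ‖G (u (k + 1))‖ := by
    simpa using norm_add_le (G (u (k + 2)) - G (u (k + 1))) (G (u (k + 1)))
  have h6 := mul_le_mul_of_nonneg_left h3 (show 0 ≤ 2 * M by linarith)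
  have h7 : 2 * M * (2 / m * ‖G (u (k + 1))‖) = 4 * M / m * ‖G (u (k + 1))‖ := by ring
  linarith

lemma norm_add_le_pow (h : NearlyLinear G uStar T m M η W) (hm : 0 < m) (hM : m ≤ M)
    (hη : η ≤ m / 2) (hu : IsBBSequence G c u) {K : ℕ} (hW : ∀ i ≤ K, u i ∈ W) (k j : ℕ)
    (hk : k + 1 + j ≤ K) : ‖G (u (k + 1 + j))‖ ≤ (1 + 4 * M / m) ^ j * ‖G (u (k + 1))‖ := by
  induction j with
  | zero => simp
  | succ j ih =>
    have h1 := h.norm_succ_le hm hM hη hu (hW (k + j) (by omega)) (hW (k + j + 1) (by omega))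
      (hW (k + j + 2) (by omega))
    rw [show k + j + 2 = k + 1 + (j + 1) by omega, show k + j + 1 = k + 1 + j by omega] at h1
    have h2 : 0 < 1 + 4 * M / m := by
      have : 0 < M := hm.trans_le hM
      positivity
    calc _ ≤ _ := h1
      _ ≤ (1 + 4 * M / m) * ((1 + 4 * M / m) ^ j * ‖G (u (k + 1))‖) := by
          gcongr; exact ih (by omega)
      _ = _ := by ring

end NearlyLinear

/-- The gradients form an admissible operator iteration: the near-linearity of G controls both its
error and its delayed Rayleigh bound. -/
theorem exists_gradient_le_half {m M : ℝ} (hm : 0 < m) (hM : m ≤ M) :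
    ∃ (n : ℕ) (η : ℝ), 0 < η ∧ η ≤ m / 2 ∧ ∀ (G : H → H) (uStar : H) (T : H →L[ℝ] H) (W : Set H)
      (c : ℕ → StepRule) (u : ℕ → H), NearlyLinear G uStar T m M η W → IsBBSequence G c u →
      ∀ K, (∀ i ≤ K, u i ∈ W) → ∀ k, k + 1 + n ≤ K →
      ∃ j ≤ n, ‖G (u (k + 1 + j))‖ ≤ 1 / 2 * ‖G (u (k + 1))‖ := by
  have hM0 : 0 < M := hm.trans_le hM
  have hM2 : M ≤ 8 * M ^ 2 / m := by
    rw [le_div_iff₀ hm]; nlinarith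
  -- The upper bound M is enlarged to 8M²/m, which also dominates the step-sizes of both rules.
  obtain ⟨n, η, hη, hn⟩ := exists_norm_le_half (H := H) hm (hM.trans hM2)
  have hη₀ : min (m / 12) (η * (m / 2)) ≤ m / 2 := (min_le_left _ _).trans (by linarith)
  refine ⟨n, min (m / 12) (η * (m / 2)), by positivity, hη₀, fun G uStar T W c u h hu K hW k hk => ?_⟩
  -- Without halving no gradient in the window vanishes, so consecutive iterates differ and all
  -- step-sizes are genuine.
  by_contra! hcon
  have hne : ∀ i ≤ n, u (k + i + 1) ≠ u (k + i) := fun i hi => by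
    refine h.succ_ne hm hη₀ hu hW _ (by omega) ?_
    have := hcon i hi
    rw [show k + 1 + i = k + i + 1 by omega] at this
    exact norm_pos_iff.1 (lt_of_le_of_lt (by positivity) this)
  set a : ℕ → ℝ := fun i => stepSize (c (k + i + 1)) (u (k + i + 1) - u (k + i))
    (G (u (k + i + 1)) - G (u (k + i))) with ha
  have hag : ∀ i ≤ n, m / 2 ≤ a i := fun i hi =>
    h.le_stepSize hm hη₀ (hW _ (by omega)) (hW _ (by omega)) (hne i hi) _
  have hstep : ∀ i, u (k + i + 2) - u (k + i + 1) = -((1 / a i) • G (u (k + i + 1))) := fun i => by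
    rw [hu.step, sub_sub_cancel_left]
  obtain ⟨j, hj, hle⟩ := hn T (fun i => G (u (k + i + 1))) a h.symm h.coercive
    (h.opNorm_le.trans hM2) (fun i hi => hag i hi.le)
    (fun i hi => h.stepSize_le hm hM hη₀ (hW _ (by omega)) (hW _ (by omega)) (hne i hi.le) _)
    (fun i hi => by
      -- The difference of iterates is a multiple of the previous gradient, so both have the same
      -- Rayleigh quotient.
      have h1 := h.rayleigh_le_stepSize hm hη₀ (hW (k + i + 2) (by omega))
        (hW (k + i + 1) (by omega)) (hne (i + 1) (by omega)) (c (k + i + 2))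
      rw [show stepSize (c (k + i + 2)) (u (k + i + 2) - u (k + i + 1))
        (G (u (k + i + 2)) - G (u (k + i + 1))) = a (i + 1) from rfl, hstep] at h1
      have hai : 0 < a i := by linarith [hag i (by omega)]
      rw [map_neg, inner_neg_neg, map_smul, inner_smul_left, inner_smul_right, norm_neg, norm_smul,
        mul_pow, Real.norm_eq_abs, sq_abs] at h1
      have h2 : inner ℝ (T (G (u (k + i + 1)))) (G (u (k + i + 1))) ≤
          (a (i + 1) + min (m / 12) (η * (m / 2))) * ‖G (u (k + i + 1))‖ ^ 2 := by
        refine le_of_mul_le_mul_left ?_ (show 0 < (1 / a i) ^ 2 by positivity)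
        simp only [conj_trivial] at h1
        linarith
      refine h2.trans ?_
      gcongr
      exact min_le_left _ _)
    (fun i hi => by
      have hai : 0 < a i := by linarith [hag i (by omega)]
      have h1 := h.approx _ (hW (k + i + 2) (by omega)) _ (hW (k + i + 1) (by omega))
      have h2 : G (u (k + (i + 1) + 1)) - (G (u (k + i + 1)) - (1 / a i) • T (G (u (k + i + 1)))) =
          G (u (k + i + 2)) - G (u (k + i + 1)) - T (u (k + i + 2) - u (k + i + 1)) := by
        rw [hstep, map_neg, map_smul, show k + (i + 1) + 1 = k + i + 2 by omega]
        abel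
      rw [h2]
      refine h1.trans ?_
      rw [hstep, norm_neg, norm_smul, Real.norm_of_nonneg (by positivity), ← mul_assoc]
      gcongr
      rw [mul_one_div, div_le_iff₀ hai]
      exact (min_le_right _ _).trans (by gcongr; exact hag i hi.le))
  have := hcon j hj
  rw [show k + 1 + j = k + j + 1 by omega] at this
  exact absurd hle (not_le.2 this)

/-- R-linear decay of the gradients along BB sequences, as long as the iterates stay in `W`. -/
theorem exists_gradient_le_pow {m M : ℝ} (hm : 0 < m) (hM : m ≤ M) :
    ∃ η C θ : ℝ, 0 < η ∧ η ≤ m / 2 ∧ 0 < C ∧ 0 < θ ∧ θ < 1 ∧ ∀ (G : H → H) (uStar : H)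
      (T : H →L[ℝ] H) (W : Set H) (c : ℕ → StepRule) (u : ℕ → H),
      NearlyLinear G uStar T m M η W → IsBBSequence G c u →
      ∀ K, (∀ i ≤ K, u i ∈ W) → ∀ j k, k + 1 + j ≤ K →
      ‖G (u (k + 1 + j))‖ ≤ C * θ ^ j * ‖G (u (k + 1))‖ := by
  obtain ⟨n, η, hη, hη1, hn⟩ := exists_gradient_le_half (H := H) hm hM
  have hM0 : 0 < M := hm.trans_le hM
  set L : ℝ := 1 + 4 * M / m with hL
  have hL1 : 1 ≤ L := by
    have : 0 ≤ 4 * M / m := by positivity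
    linarith
  -- Bernoulli's inequality for 1 - 1/(2(n+1)); this form also covers n = 0.
  obtain ⟨θ, hθ0, hθ1, hθn⟩ : ∃ θ : ℝ, 0 < θ ∧ θ < 1 ∧ 1 / 2 ≤ θ ^ n := by
    refine ⟨1 - 1 / (2 * (n + 1)), ?_, ?_, ?_⟩
    · rw [sub_pos, div_lt_one (by positivity)]; linarith [Nat.cast_nonneg (α := ℝ) n]
    · have : (0 : ℝ) < 1 / (2 * (n + 1)) := by positivity
      linarith
    · have h1 : (1 : ℝ) / (2 * (n + 1)) ≤ 1 := by
        rw [div_le_one (by positivity)]; linarith [Nat.cast_nonneg (α := ℝ) n]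
      have h2 := one_add_mul_le_pow (show (-2 : ℝ) ≤ -(1 / (2 * (n + 1))) by linarith) n
      rw [← sub_eq_add_neg] at h2
      refine le_trans ?_ h2
      have : (n : ℝ) * (1 / (2 * (n + 1))) ≤ 1 / 2 := by
        rw [mul_one_div, div_le_div_iff₀ (by positivity) (by norm_num)]; linarith
      linarith
  -- The constant absorbs up to n steps of growth by L; longer stretches are cut at the first
  -- halving found.
  refine ⟨η, (L / θ) ^ n, θ, hη, hη1, by positivity, hθ0, hθ1,
    fun G uStar T W c u h hu K hW j => ?_⟩
  induction j using Nat.strong_induction_on with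
  | _ j ih =>
    intro k hk
    have hgrow := h.norm_add_le_pow hm hM hη1 hu hW k
    rcases eq_or_ne (G (u (k + 1))) 0 with h0 | h0
    · simpa [h0] using hgrow j hk
    rcases le_or_gt j n with hjn | hjn
    · refine (hgrow j hk).trans ?_
      gcongr
      calc L ^ j = (L / θ) ^ j * θ ^ j := by rw [← mul_pow, div_mul_cancel₀ _ hθ0.ne']
        _ ≤ (L / θ) ^ n * θ ^ j := by
            gcongr
            rw [le_div_iff₀ hθ0]; linarith
    · obtain ⟨i, hin, hi⟩ := hn G uStar T W c u h hu K hW k (by omega)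
      have hi0 : i ≠ 0 := by
        rintro rfl
        have := norm_pos_iff.2 h0
        simp only [add_zero] at hi
        linarith
      have h1 := ih (j - i) (by omega) (k + i) (by omega)
      rw [show k + i + 1 + (j - i) = k + 1 + j by omega, show k + i + 1 = k + 1 + i by omega] at h1
      have h2 : 1 / 2 ≤ θ ^ i := hθn.trans (pow_le_pow_of_le_one hθ0.le hθ1.le hin)
      calc ‖G (u (k + 1 + j))‖ ≤ (L / θ) ^ n * θ ^ (j - i) * ‖G (u (k + 1 + i))‖ := h1
        _ ≤ (L / θ) ^ n * θ ^ (j - i) * (θ ^ i * ‖G (u (k + 1))‖) := by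
            gcongr
            exact hi.trans (by gcongr)
        _ = (L / θ) ^ n * θ ^ (j - i + i) * ‖G (u (k + 1))‖ := by ring
        _ = _ := by rw [Nat.sub_add_cancel (by omega)]

/-- If the gradients decay, then BB sequences starting close to `uStar` stay close to it. -/
lemma NearlyLinear.mem_ball {G : H → H} {uStar : H} {T : H →L[ℝ] H} {m M η C θ r : ℝ}
    {c : ℕ → StepRule} {u : ℕ → H}
    (h : NearlyLinear G uStar T m M η (Metric.ball uStar r)) (hm : 0 < m) (hM : m ≤ M)
    (hη : η ≤ m / 2) (hC : 0 < C) (hθ0 : 0 < θ) (hθ1 : θ < 1) (hu : IsBBSequence G c u)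
    (hdecay : ∀ K, (∀ i ≤ K, u i ∈ Metric.ball uStar r) → ∀ j k, k + 1 + j ≤ K →
      ‖G (u (k + 1 + j))‖ ≤ C * θ ^ j * ‖G (u (k + 1))‖)
    (h0 : u 0 ∈ Metric.ball uStar (r / (1 + 8 * M * C / m)))
    (h1 : u 1 ∈ Metric.ball uStar (r / (1 + 8 * M * C / m))) (k : ℕ) :
    u k ∈ Metric.ball uStar r := by
  have hM0 : 0 < M := hm.trans_le hM
  have hr : 0 < r := by simpa using h.mem
  set Q := 1 + 8 * M * C / m with hQ
  have hq : 0 < 8 * M * C / m := by positivity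
  have hQ1 : r / Q ≤ r := div_le_self hr.le (by linarith)
  -- Bootstrapping: decay up to K + 1 needs only the iterates up to K + 1 in the ball, and it places
  -- the next one there too.
  suffices ∀ K, ∀ i ≤ K, u i ∈ Metric.ball uStar r from this k k le_rfl
  intro K
  induction K with
  | zero =>
    intro i hi
    rw [Nat.le_zero.1 hi]
    exact Metric.ball_subset_ball hQ1 h0
  | succ K ih =>
    intro i hi
    rcases Nat.lt_or_ge i (K + 1) with hlt | hge
    · exact ih i (by omega)
    obtain rfl : i = K + 1 := le_antisymm hi hge
    cases K with
    | zero => exact Metric.ball_subset_ball hQ1 h1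
    | succ K =>
      have h2 := h.norm_step_le hm hη hu (ih K (by omega)) (ih (K + 1) le_rfl)
      have h3 := h.norm_error_le hm hη (ih (K + 1) le_rfl)
      have h4 := hdecay (K + 1) ih K 0 (by omega)
      rw [show 0 + 1 + K = K + 1 by omega, zero_add] at h4
      have h5 := h.norm_le (by linarith) (ih 1 (by omega))
      have h6 : ‖u (K + 2) - uStar‖ ≤ ‖u (K + 2) - u (K + 1)‖ + ‖u (K + 1) - uStar‖ := by
        simpa using norm_add_le (u (K + 2) - u (K + 1)) (u (K + 1) - uStar)
      have h7 : ‖u (K + 2) - uStar‖ ≤ 8 * M * C / m * ‖u 1 - uStar‖ := by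
        calc ‖u (K + 2) - uStar‖ ≤ 4 / m * ‖G (u (K + 1))‖ := by
              have : 4 / m = 2 / m + 2 / m := by ring
              rw [this]; linarith
          _ ≤ 4 / m * (C * 1 * (2 * M * ‖u 1 - uStar‖)) := by
              gcongr
              refine h4.trans ?_
              gcongr
              exact pow_le_one₀ hθ0.le hθ1.le
          _ = _ := by ring
      rw [mem_ball_iff_norm] at h1 ⊢
      rw [lt_div_iff₀ (by positivity), hQ] at h1
      have := norm_nonneg (u 1 - uStar)
      change ‖u (K + 2) - uStar‖ < r
      linarith

end LocalConvergence

/-! ### The gradient of F as a perturbation of its Hessian -/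

section Hessian

variable {H : Type*} [NormedAddCommGroup H] [InnerProductSpace ℝ H] [CompleteSpace H]

/-- The Hessian of `F` at `uStar` as an operator. -/
noncomputable def hessian (F : H → ℝ) (uStar : H) : H →L[ℝ] H :=
  InnerProductSpace.continuousLinearMapOfBilin (𝕜 := ℝ) (fderiv ℝ (fderiv ℝ F) uStar)

lemma inner_hessian (F : H → ℝ) (uStar v w : H) :
    inner ℝ (hessian F uStar v) w = fderiv ℝ (fderiv ℝ F) uStar v w :=
  InnerProductSpace.continuousLinearMapOfBilin_apply (𝕜 := ℝ) (fderiv ℝ (fderiv ℝ F) uStar) v w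

lemma norm_gradient_sub_sub_hessian_le (F : H → ℝ) (uStar x y v : H) {b : ℝ}
    (hb : ‖fderiv ℝ F x - fderiv ℝ F y - fderiv ℝ (fderiv ℝ F) uStar v‖ ≤ b) :
    ‖gradient F x - gradient F y - hessian F uStar v‖ ≤ b := by
  refine le_trans (le_of_eq ?_) hb
  rw [← (InnerProductSpace.toDual ℝ H).norm_map]
  congr 1
  ext w
  simp [inner_hessian]

variable {F : H → ℝ} {uStar : H} {δinf δsup : ℝ}

lemma LocalAssumptions.nearlyLinear (hF : LocalAssumptions F uStar δinf δsup) {W : Set H} {η : ℝ}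
    (hW : uStar ∈ W) (happrox : ∀ x ∈ W, ∀ y ∈ W,
      ‖fderiv ℝ F x - fderiv ℝ F y - fderiv ℝ (fderiv ℝ F) uStar (x - y)‖ ≤ η * ‖x - y‖) :
    NearlyLinear (gradient F) uStar (hessian F uStar) δinf (max δinf ‖hessian F uStar‖) η W where
  symm v w := by
    rw [inner_hessian, real_inner_comm, inner_hessian]
    exact (hF.contDiff.contDiffAt.isSymmSndFDerivAt (by simp)).eq v w
  coercive v := by rw [inner_hessian]; exact hF.lower v
  opNorm_le := le_max_right _ _
  mem := hW
  zero := by rw [gradient, hF.localMin.fderiv_eq_zero, map_zero]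
  approx x hx y hy := norm_gradient_sub_sub_hessian_le F uStar x y _ (happrox x hx y hy)

/-- A continuously differentiable map is strictly differentiable, which is exactly an η-Lipschitz
bound for the nonlinear remainder on a small ball. -/
lemma LocalAssumptions.exists_nearlyLinear_ball (hF : LocalAssumptions F uStar δinf δsup) {η : ℝ}
    (hη : 0 < η) : ∃ r > 0, NearlyLinear (gradient F) uStar (hessian F uStar) δinf
      (max δinf ‖hessian F uStar‖) η (Metric.ball uStar r) := by
  have h1 : ContDiff ℝ 1 (fderiv ℝ F) := hF.contDiff.fderiv_right (by norm_num)
  have h2 : HasStrictFDerivAt (fderiv ℝ F) (fderiv ℝ (fderiv ℝ F) uStar) uStar :=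
    h1.contDiffAt.hasStrictFDerivAt (by simp)
  obtain ⟨s, hs, happ⟩ := h2.approximates_deriv_on_nhds (c := ⟨η, hη.le⟩) (Or.inr hη)
  obtain ⟨r, hr, hrs⟩ := Metric.mem_nhds_iff.1 hs
  exact ⟨r, hr, hF.nearlyLinear (Metric.mem_ball_self hr)
    fun x hx y hy => happ x (hrs hx) y (hrs hy)⟩

/-- The gradient is affine, so the remainder vanishes everywhere; this removes the need for initial
iterates near `uStar`. -/
lemma LocalAssumptions.nearlyLinear_univ (hF : LocalAssumptions F uStar δinf δsup)
    (hq : IsStrictlyConvexQuadratic F) {η : ℝ} (hη : 0 ≤ η) :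
    NearlyLinear (gradient F) uStar (hessian F uStar) δinf (max δinf ‖hessian F uStar‖) η
      Set.univ := by
  obtain ⟨A, b, γ, hA, -, hFA⟩ := hq
  have h1 : ∀ x, HasFDerivAt F (innerSL ℝ (A x) - innerSL ℝ b) x := by
    intro x
    have h2 := (((A.hasFDerivAt (x := x)).inner ℝ (hasFDerivAt_id x)).const_mul (1 / 2)).sub
      ((innerSL ℝ b).hasFDerivAt (x := x))
    have h3 := h2.add_const γ
    refine (h3.congr_fderiv ?_).congr_of_eventuallyEq (Eventually.of_forall fun u => ?_)
    · ext w
      simp [hA w x, real_inner_comm w (A x)]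
      ring
    · simp [hFA]
  have h4 : fderiv ℝ F = fun x => ((innerSL ℝ).comp A) x - innerSL ℝ b := by
    ext1 x; exact (h1 x).fderiv
  have h5 : fderiv ℝ (fderiv ℝ F) uStar = (innerSL ℝ).comp A := by
    rw [h4]
    exact ((((innerSL ℝ).comp A).hasFDerivAt (x := uStar)).sub_const _).fderiv
  refine hF.nearlyLinear (Set.mem_univ _) fun x _ y _ => ?_
  rw [h5, h4, map_sub]
  simp
  positivity

end Hessian

/-! ### Convergence of the discrete iterates and stopping indices -/

section Discretization

variable {H : Type*} [NormedAddCommGroup H] [InnerProductSpace ℝ H]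
  {Hh : ℝ → Type*} [∀ h, NormedAddCommGroup (Hh h)] [∀ h, InnerProductSpace ℝ (Hh h)]
  {P : ∀ h, Hh h →ₗ[ℝ] H} {v w : ∀ h, Hh h} {x y : H}

lemma hConverges_iff : HConverges P v x ↔ Tendsto (fun h => P h (v h)) (𝓝[>] 0) (𝓝 x) :=
  tendsto_iff_norm_sub_tendsto_zero.symm

lemma HConverges.sub (hv : HConverges P v x) (hw : HConverges P w y) :
    HConverges P (fun h => v h - w h) (x - y) := by
  rw [hConverges_iff] at *
  simpa using Tendsto.sub hv hw

lemma HConverges.smul {t : ℝ → ℝ} {t₀ : ℝ} (ht : Tendsto t (𝓝[>] 0) (𝓝 t₀))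
    (hv : HConverges P v x) : HConverges P (fun h => t h • v h) (t₀ • x) := by
  rw [hConverges_iff] at *
  simpa using Tendsto.smul ht hv

lemma HConverges.congr (hv : HConverges P v x) (hvw : ∀ h, 0 < h → v h = w h) :
    HConverges P w x := by
  rw [hConverges_iff] at *
  refine hv.congr' ?_
  filter_upwards [self_mem_nhdsWithin] with h hh
  rw [hvw h hh]

lemma HConverges.norm (hP : InnerConsistent P) (hv : HConverges P v x) :
    Tendsto (fun h => ‖v h‖) (𝓝[>] 0) (𝓝 ‖x‖) := by
  have := (hP v v x x hv hv).sqrt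
  simpa only [← norm_eq_sqrt_real_inner] using this

lemma HConverges.one_div_stepSize (hP : InnerConsistent P) (hv : HConverges P v x)
    (hw : HConverges P w y) (hxy : inner ℝ x y ≠ 0) (r : StepRule) :
    Tendsto (fun h => 1 / stepSize r (v h) (w h)) (𝓝[>] 0) (𝓝 (1 / stepSize r x y)) := by
  cases r with
  | bb1 =>
    simp only [stepSize, one_div_div]
    exact (hP _ _ _ _ hv hv).div (hP _ _ _ _ hv hw) hxy
  | bb2 =>
    simp only [stepSize, one_div_div]
    refine (hP _ _ _ _ hv hw).div (hP _ _ _ _ hw hw) fun h0 => hxy ?_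
    rw [inner_self_eq_zero.1 h0, inner_zero_right]

variable {Gh : ∀ h, Hh h → Hh h} {G : H → H} {U : Set H} {c : ℕ → StepRule} {u : ℕ → H}
  {uh : ∀ h, ℕ → Hh h}

/-- Each step is continuous in the two preceding iterates wherever (s, y) ≠ 0. The recursion has
order two, so the induction carries two consecutive iterates. -/
lemma hConverges_iterate (hP : InnerConsistent P) (hG : GradientConsistentOn P Gh G U)
    (hU : ∀ k, u k ∈ U) (hu : IsBBSequence G c u)
    (huh : ∀ h : ℝ, 0 < h → IsBBSequence (Gh h) c (uh h))
    (h0 : HConverges P (fun h => uh h 0) (u 0)) (h1 : HConverges P (fun h => uh h 1) (u 1)) {K : ℕ}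
    (hK : ∀ k, k + 1 < K → inner ℝ (u (k + 1) - u k) (G (u (k + 1)) - G (u k)) ≠ (0 : ℝ)) :
    ∀ k ≤ K, HConverges P (fun h => uh h k) (u k) := by
  suffices ∀ k ≤ K, HConverges P (fun h => uh h k) (u k) ∧
      (k + 1 ≤ K → HConverges P (fun h => uh h (k + 1)) (u (k + 1))) from fun k hk => (this k hk).1
  intro k
  induction k with
  | zero => exact fun _ => ⟨h0, fun _ => h1⟩
  | succ k ih =>
    intro hk
    obtain ⟨hc, hc'⟩ := ih (by omega)
    have hc1 := hc' hk
    refine ⟨hc1, fun hk2 => ?_⟩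
    have hg1 := hG _ _ (hU (k + 1)) hc1
    have hy := hg1.sub (hG _ _ (hU k) hc)
    have ht := (hc1.sub hc).one_div_stepSize hP hy (hK k (by omega)) (c (k + 1))
    rw [hu.step]
    exact (hc1.sub (hg1.smul ht)).congr fun h hh => ((huh h hh).step k).symm

theorem exists_stopIndex_of_consistent {uStar : H} {T : H →L[ℝ] H} {m M η C θ : ℝ} {W : Set H}
    {ℓ : ℕ} (hN : NearlyLinear G uStar T m M η W) (hm : 0 < m) (hη : η ≤ m / 2) (hθ0 : 0 < θ)
    (hθ1 : θ < 1) (hℓ : C * θ ^ ℓ < 1)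
    (hu : IsBBSequence G c u) (hW : ∀ k, u k ∈ W)
    (hdecay : ∀ j k, ‖G (u (k + 1 + j))‖ ≤ C * θ ^ j * ‖G (u (k + 1))‖)
    (hP : InnerConsistent P) (hU : ∀ k, u k ∈ U) (hG : GradientConsistentOn P Gh G U)
    (huh : ∀ h : ℝ, 0 < h → IsBBSequence (Gh h) c (uh h))
    (h0 : HConverges P (fun h => uh h 0) (u 0)) (h1 : HConverges P (fun h => uh h 1) (u 1))
    {ε : ℝ} (hε : 0 < ε) :
    ∃ K : ℕ, IsStopIndex G u ε K ∧ ∃ hε : ℝ, 0 < hε ∧ ∀ h : ℝ, 0 < h → h ≤ hε →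
      ∃ Kh : ℕ, IsStopIndex (Gh h) (uh h) ε Kh ∧ (K : ℤ) - (ℓ : ℤ) ≤ (Kh : ℤ) ∧ Kh ≤ K := by
  have hex : ∃ k, 1 ≤ k ∧ ‖G (u k)‖ < ε := by
    have h2 : Tendsto (fun j => C * θ ^ j * ‖G (u (0 + 1))‖) atTop (𝓝 (C * 0 * ‖G (u (0 + 1))‖)) :=
      ((tendsto_pow_atTop_nhds_zero_of_lt_one hθ0.le hθ1).const_mul C).mul_const _
    rw [mul_zero, zero_mul] at h2
    obtain ⟨j, hj⟩ := (h2.eventually (gt_mem_nhds hε)).exists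
    exact ⟨0 + 1 + j, by omega, (hdecay j 0).trans_lt hj⟩
  obtain ⟨K, hK⟩ : ∃ K, IsStopIndex G u ε K := by
    classical
    exact ⟨Nat.find hex, Nat.find_spec hex, fun k hk => Nat.find_min' hex hk⟩
  refine ⟨K, hK, ?_⟩
  have hbig : ∀ k, 1 ≤ k → k < K → ε ≤ ‖G (u k)‖ := fun k hk1 hkK => by
    by_contra! hlt
    exact absurd (hK.2 ⟨hk1, hlt⟩) (by omega)
  -- Before K the gradient has norm at least ε, so the method has not stopped and strong
  -- monotonicity gives (s, y) > 0.
  have hconv := hConverges_iterate hP hG hU hu huh h0 h1 (K := K) fun k hk => by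
    have hne : u (k + 1) ≠ u k := by
      refine hN.succ_ne hm hη hu (K := K) (fun i _ => hW i) k hk.le ?_
      exact norm_pos_iff.1 (hε.trans_le (hbig (k + 1) (by omega) hk))
    have hs : 0 < ‖u (k + 1) - u k‖ := norm_pos_iff.2 (sub_ne_zero.2 hne)
    exact (lt_of_lt_of_le (by positivity) (hN.le_inner hη (hW (k + 1)) (hW k))).ne'
  have hnorm : ∀ k ≤ K, Tendsto (fun h => ‖Gh h (uh h k)‖) (𝓝[>] 0) (𝓝 ‖G (u k)‖) :=
    fun k hk => (hG _ _ (hU k) (hconv k hk)).norm hP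
  -- Just before K the norm may equal ε, which does not survive discretization; going back ℓ more
  -- steps makes the inequality strict.
  have hstrict : ∀ k, 1 ≤ k → k + ℓ < K → ε < ‖G (u k)‖ := fun k hk1 hkK => by
    obtain ⟨k, rfl⟩ := Nat.exists_eq_add_of_le' hk1
    have hpos := hε.trans_le (hbig (k + 1) (by omega) (by omega))
    calc ε ≤ ‖G (u (k + 1 + ℓ))‖ := hbig _ (by omega) hkK
      _ ≤ C * θ ^ ℓ * ‖G (u (k + 1))‖ := hdecay ℓ k
      _ < 1 * ‖G (u (k + 1))‖ := by gcongr
      _ = _ := one_mul _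
  have hev : ∀ᶠ h in 𝓝[>] (0 : ℝ), ‖Gh h (uh h K)‖ < ε ∧
      ∀ k ∈ Finset.range K, 1 ≤ k → k + ℓ < K → ε < ‖Gh h (uh h k)‖ := by
    refine ((hnorm K le_rfl).eventually (gt_mem_nhds hK.1.2)).and ?_
    rw [Finset.eventually_all]
    intro k hk
    by_cases hc : 1 ≤ k ∧ k + ℓ < K
    · filter_upwards [(hnorm k (by omega)).eventually (lt_mem_nhds (hstrict k hc.1 hc.2))]
        with h hh _ _ using hh
    · exact Eventually.of_forall fun h h2 h3 => absurd ⟨h2, h3⟩ hc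
  obtain ⟨b, hb, hsub⟩ := mem_nhdsGT_iff_exists_Ioc_subset.1 hev
  refine ⟨b, hb, fun h hh0 hhb => ?_⟩
  obtain ⟨hlt, hgt⟩ := hsub ⟨hh0, hhb⟩
  have hexh : ∃ k, 1 ≤ k ∧ ‖Gh h (uh h k)‖ < ε := ⟨K, hK.1.1, hlt⟩
  obtain ⟨Kh, hKh⟩ : ∃ Kh, IsStopIndex (Gh h) (uh h) ε Kh := by
    classical
    exact ⟨Nat.find hexh, Nat.find_spec hexh, fun k hk => Nat.find_min' hexh hk⟩
  refine ⟨Kh, hKh, ?_, hKh.2 ⟨hK.1.1, hlt⟩⟩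
  by_contra! hcon
  have := hgt Kh (Finset.mem_range.2 (by omega)) hKh.1.1 (by omega)
  exact lt_asymm this hKh.1.2

end Discretization

end BB

theorem theorem7 {H : Type*} [NormedAddCommGroup H] [InnerProductSpace ℝ H]
    [CompleteSpace H] (F : H → ℝ) (uStar : H) (δinf δsup : ℝ)
    (hF : BB.LocalAssumptions F uStar δinf δsup) :
    -- the constants depend only on `F` and `uStar`
    ∃ (ζ lam₁ lam₂ θ : ℝ) (ℓ : ℕ),
      0 < ζ ∧ 0 < lam₁ ∧ 0 < lam₂ ∧ 0 < θ ∧ θ < 1 ∧ 0 < ℓ ∧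
      -- local R-linear convergence from initial iterates in the ball of radius `ζ`
      (∀ (c : ℕ → BB.StepRule) (u : ℕ → H), BB.IsBBSequence (gradient F) c u →
        u 0 ∈ Metric.ball uStar ζ → u 1 ∈ Metric.ball uStar ζ →
        ∀ k : ℕ, 1 ≤ k →
          ‖u k - uStar‖ ≤ lam₁ * θ ^ k * ‖u 1 - uStar‖ ∧
          ‖gradient F (u k)‖ ≤ lam₂ * θ ^ k * ‖gradient F (u 1)‖) ∧
      -- sequences with initial iterates close enough to `uStar` stay in a given neighbourhood
      (∀ U ∈ nhds uStar, ∃ ρ : ℝ, 0 < ρ ∧ ρ ≤ ζ ∧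
        ∀ (c : ℕ → BB.StepRule) (u : ℕ → H), BB.IsBBSequence (gradient F) c u →
          u 0 ∈ Metric.ball uStar ρ → u 1 ∈ Metric.ball uStar ρ → ∀ k : ℕ, u k ∈ U) ∧
      -- mesh independence
      (∀ (Hh : ℝ → Type*) [∀ h, NormedAddCommGroup (Hh h)] [∀ h, InnerProductSpace ℝ (Hh h)]
        [∀ h, FiniteDimensional ℝ (Hh h)]
        (Gh : ∀ h, Hh h → Hh h) (P : ∀ h, Hh h →ₗ[ℝ] H) (U : Set H)
        (c : ℕ → BB.StepRule) (u : ℕ → H) (uh : ∀ h, ℕ → Hh h),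
        (∀ h : ℝ, 0 < h → Continuous (Gh h)) →
        BB.IsBBSequence (gradient F) c u →
        ((u 0 ∈ Metric.ball uStar ζ ∧ u 1 ∈ Metric.ball uStar ζ) ∨
          BB.IsStrictlyConvexQuadratic F) →
        BB.InnerConsistent P →
        U ∈ nhds uStar → (∀ k : ℕ, u k ∈ U) →
        BB.GradientConsistentOn P Gh (gradient F) U →
        (∀ h : ℝ, 0 < h → BB.IsBBSequence (Gh h) c (uh h)) →
        BB.HConverges P (fun h => uh h 0) (u 0) →
        BB.HConverges P (fun h => uh h 1) (u 1) →
        ∀ ε : ℝ, 0 < ε →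
          ∃ K : ℕ, BB.IsStopIndex (gradient F) u ε K ∧
            ∃ hε : ℝ, 0 < hε ∧ ∀ h : ℝ, 0 < h → h ≤ hε →
              ∃ Kh : ℕ, BB.IsStopIndex (Gh h) (uh h) ε Kh ∧
                (K : ℤ) - (ℓ : ℤ) ≤ (Kh : ℤ) ∧ Kh ≤ K) := by

  set T := BB.hessian F uStar
  -- The maximum ensures δinf ≤ M even in the trivial space.
  set M := max δinf ‖T‖
  have hm := hF.δinf_pos
  have hM : δinf ≤ M := le_max_left _ _
  have hM0 : 0 < M := hm.trans_le hM
  obtain ⟨η, C, θ, hη, hη1, hC, hθ0, hθ1, hdecay⟩ := BB.exists_gradient_le_pow (H := H) hm hM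
  obtain ⟨r, hr, hN⟩ := hF.exists_nearlyLinear_ball hη
  obtain ⟨ℓ, hℓ⟩ := exists_pow_lt_of_lt_one (show 0 < 1 / C by positivity) hθ1
  have hℓ' : C * θ ^ (ℓ + 1) < 1 := by
    rw [lt_div_iff₀ hC] at hℓ
    calc C * θ ^ (ℓ + 1) = θ ^ ℓ * C * θ := by ring
      _ ≤ θ ^ ℓ * C * 1 := by gcongr
      _ < 1 := by linarith
  set Q := 1 + 8 * M * C / δinf
  have hQ : 1 ≤ Q := by
    have : 0 < 8 * M * C / δinf := by positivity
    simp only [Q]; linarith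
  have hball : ∀ (r' : ℝ) (c : ℕ → BB.StepRule) (u : ℕ → H), 0 < r' → r' ≤ r →
      BB.IsBBSequence (gradient F) c u → u 0 ∈ Metric.ball uStar (r' / Q) →
      u 1 ∈ Metric.ball uStar (r' / Q) → ∀ k, u k ∈ Metric.ball uStar r' := by
    intro r' c u hr' hle hu h0 h1 k
    have hN' := hN.mono (Metric.ball_subset_ball hle) (Metric.mem_ball_self hr')
    exact hN'.mem_ball hm hM hη1 hC hθ0 hθ1 hu
      (fun K hK => hdecay _ _ _ _ _ _ hN' hu K hK) h0 h1 k
  -- C/θ accounts for decay starting at index 1; 2/δinf and 2M translate between errors and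
  -- gradients.
  refine ⟨r / Q, 2 / δinf * (C / θ) * (2 * M), C / θ, θ, ℓ + 1, by positivity, by positivity,
    by positivity, hθ0, hθ1, by omega, ?_, ?_, ?_⟩
  · intro c u hu h0 h1 k hk
    have hmem := hball r c u hr le_rfl hu h0 h1
    obtain ⟨k, rfl⟩ := Nat.exists_eq_add_of_le' hk
    have h2 : ‖gradient F (u (k + 1))‖ ≤ C / θ * θ ^ (k + 1) * ‖gradient F (u 1)‖ := by
      have h3 := hdecay _ _ _ _ _ _ hN hu (k + 1) (fun i _ => hmem i) k 0 (by omega)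
      rw [show 0 + 1 + k = k + 1 by omega, zero_add] at h3
      have : C / θ * θ ^ (k + 1) = C * θ ^ k := by
        rw [pow_succ]; field_simp
      rwa [this]
    refine ⟨?_, h2⟩
    calc ‖u (k + 1) - uStar‖ ≤ 2 / δinf * ‖gradient F (u (k + 1))‖ :=
          hN.norm_error_le hm hη1 (hmem _)
      _ ≤ 2 / δinf * (C / θ * θ ^ (k + 1) * (2 * M * ‖u 1 - uStar‖)) := by
          gcongr
          refine h2.trans ?_
          gcongr
          exact hN.norm_le (by linarith) (hmem 1)
      _ = _ := by ring
  · intro U hU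
    obtain ⟨s, hs, hsU⟩ := Metric.mem_nhds_iff.1 hU
    refine ⟨min r s / Q, by positivity, by gcongr; exact min_le_left _ _, fun c u hu h0 h1 k => ?_⟩
    exact hsU (Metric.ball_subset_ball (min_le_right _ _)
      (hball _ c u (lt_min hr hs) (min_le_left _ _) hu h0 h1 k))
  · intro Hh _ _ _ Gh P U c u uh _ hu hcase hP _ hU hG huh h0 h1 ε hε
    obtain ⟨W, hNW, hW⟩ : ∃ W, BB.NearlyLinear (gradient F) uStar T δinf M η W ∧ ∀ k, u k ∈ W := by
      rcases hcase with ⟨h2, h3⟩ | hq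
      · exact ⟨_, hN, hball r c u hr le_rfl hu h2 h3⟩
      · exact ⟨_, hF.nearlyLinear_univ hq hη.le, fun k => Set.mem_univ _⟩
    exact BB.exists_stopIndex_of_consistent hNW hm hη1 hθ0 hθ1 hℓ' hu hW
      (fun j k => hdecay _ _ _ _ _ _ hNW hu (k + 1 + j) (fun i _ => hW i) j k le_rfl)
      hP hU hG huh h0 h1 hε
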